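/- Let $n\ge 0$, let $G$ be a group and let $k$ be a commutative $G$-ring, that is, a unital commutative ring with an action of $G$ by ring automorphisms. Let $\varepsilon\in k$ be invertible. A \emph{$G$-braided rook $n$-diagram} consists of a left and a right column of $n$ nodes, some of the left nodes being joined to distinct right nodes by braided strands (pairwise disjoint strands in $\mathbb{C}\times[0,1]$, monotone in the $[0,1]$-direction, with the nodes at the points $0,\dots,n-1$ of $\mathbb{C}$, taken up to isotopy rel endpoints), each strand carrying a label in $G$. The composite $xy$ of two diagrams is obtained by identifying the right nodes of $x$ with the left nodes of $y$, deleting the strands which do not run all the way from left to right, and multiplying labels from left to right. The \emph{$G$-braided rook algebra} $GB\mathcal{R}_n(\varepsilon)$ is the free $k$-module on the $G$-braided rook $n$-diagrams, with the $k$-bilinear multiplication in which the product of $x$ and $y$ is $\varepsilon^{c(x,y)}\,xy$, where $c(x,y)$ is the number of contractible components which are removed, that is, of middle nodes which are isolated both in $x$ and in $y$. The trivial module $\mathbb{1}$ over $GB\mathcal{R}_n(\varepsilon)$ (right or left) is $k$, where the diagrams in which all nodes are connected act as $1$ and all other diagrams act as $0$. Let $B_n$ be the braid group on $n$ strands and let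 $G^n\rtimes B_n$ be the semi-direct product in which $B_n$ acts on $G^n$ by permuting the factors; over the group algebra $k[G^n\rtimes B_n]$ let $\mathbb{1}$ be $k$ with every group element acting as $1$. Then there exists an isomorphism of graded $k$-modules \[ \mathrm{Tor}_{\star}^{GB\mathcal{R}_n(\varepsilon)}(\mathbb{1},\mathbb{1})\;\cong\;\mathrm{Tor}_{\star}^{k[G^n\rtimes B_n]}(\mathbb{1},\mathbb{1})\;=\;H_{\star}(G^n\rtimes B_n;k). \] -/

import Mathlib

universe u

open CategoryTheory
open scoped TensorProduct

noncomputable section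

/-! ### Configurations of distinct points in the plane -/

/-- The ordered configuration space of points of the plane `ℂ` labelled by `ι`: injective maps
`ι → ℂ`, with the subspace topology of the product topology. -/
abbrev Config (ι : Type) : Type := {c : ι → ℂ // Function.Injective c}

namespace Config

/-- The configuration which puts the point with label `i` at the node `e i`; node number `j` is
the point `j` of the real line in `ℂ`. -/
def nodes {n : ℕ} {ι : Type} (e : ι ↪ Fin n) : Config ι :=
  ⟨fun i => (((e i : Fin n) : ℕ) : ℂ), fun i j h => by
    apply e.injective
    apply Fin.ext
    have h' : (((e i : Fin n) : ℕ) : ℂ) = (((e j : Fin n) : ℕ) : ℂ) := h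
    exact_mod_cast h'⟩

/-- Relabelling along an injective map; for the inclusion of a subset of the labels this forgets
all the points whose label is not in the subset. -/
def relabel {ι κ : Type} (r : ι ↪ κ) : C(Config κ, Config ι) where
  toFun c := ⟨fun i => c.1 (r i), fun _ _ h => r.injective (c.2 h)⟩
  continuous_toFun := by
    refine Continuous.subtype_mk ?_ _
    exact continuous_pi fun i => (continuous_apply (r i)).comp continuous_subtype_val

end Config

/-- The isotopy classes (rel endpoints) of families of disjoint strands in `ℂ × [0,1]`, monotone
in the direction of `[0,1]`, one strand for each label `i : ι`, which runs from the left-hand node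
`a i` to the right-hand node `b i`.  These are the homotopy classes of paths, rel endpoints, in the
configuration space. -/
abbrev Strands {n : ℕ} {ι : Type} (a b : ι ↪ Fin n) : Type :=
  Path.Homotopic.Quotient (Config.nodes a) (Config.nodes b)

namespace Strands

variable {n : ℕ} {ι κ μ : Type}

/-- Relabel strands and delete the strands whose label is not in the range of `r`. -/
def relabel {a b : κ ↪ Fin n} (p : Strands a b) (r : ι ↪ κ) :
    Strands (r.trans a) (r.trans b) :=
  Path.Homotopic.Quotient.map p (Config.relabel r)

/-- Strands that do not move. -/
def straight (a : ι ↪ Fin n) : Strands a a := Path.Homotopic.Quotient.refl _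

/-- Concatenation of strands, from left to right. -/
def comp {a b c : ι ↪ Fin n} (p : Strands a b) (q : Strands b c) : Strands a c :=
  Path.Homotopic.Quotient.trans p q

/-- Reflection of strands, left to right. -/
def reflect {a b : ι ↪ Fin n} (p : Strands a b) : Strands b a :=
  Path.Homotopic.Quotient.symm p

/-- Transport along equalities of the endpoints. -/
def cast {a b a' b' : ι ↪ Fin n} (p : Strands a b) (ha : a' = a) (hb : b' = b) : Strands a' b' :=
  Path.Homotopic.Quotient.cast p (congrArg _ ha) (congrArg _ hb)

theorem cast_comp {a b a' c : ι ↪ Fin n} (p : Strands a b) (ha : a' = a) (q : Strands b c) :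
    (p.cast ha rfl).comp q = (p.comp q).cast ha rfl := by
  cases ha
  induction p using Path.Homotopic.Quotient.ind with | mk p =>
  induction q using Path.Homotopic.Quotient.ind with | mk q =>
  rfl

theorem comp_assoc {a b c d : ι ↪ Fin n} (p : Strands a b) (q : Strands b c) (r : Strands c d) :
    (p.comp q).comp r = p.comp (q.comp r) :=
  Path.Homotopic.Quotient.trans_assoc p q r

theorem straight_comp {a b : ι ↪ Fin n} (p : Strands a b) : (straight a).comp p = p :=
  Path.Homotopic.Quotient.refl_trans p

theorem comp_straight {a b : ι ↪ Fin n} (p : Strands a b) : p.comp (straight b) = p :=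
  Path.Homotopic.Quotient.trans_refl p

theorem reflect_comp {a b : ι ↪ Fin n} (p : Strands a b) : p.reflect.comp p = straight b :=
  Path.Homotopic.Quotient.symm_trans p

theorem relabel_comp {a b c : κ ↪ Fin n} (p : Strands a b) (q : Strands b c) (r : ι ↪ κ) :
    (p.comp q).relabel r = (p.relabel r).comp (q.relabel r) := by
  induction p using Path.Homotopic.Quotient.ind with | mk p =>
  induction q using Path.Homotopic.Quotient.ind with | mk q =>
  exact congr_arg Path.Homotopic.Quotient.mk (p.map_trans q (Config.relabel r).continuous)

theorem relabel_relabel {a b : μ ↪ Fin n} (p : Strands a b) (s : κ ↪ μ) (r : ι ↪ κ) :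
    (p.relabel s).relabel r = p.relabel (r.trans s) := by
  induction p using Path.Homotopic.Quotient.ind with | mk p =>
  rfl

theorem relabel_refl {a b : ι ↪ Fin n} (p : Strands a b) :
    p.relabel (Function.Embedding.refl ι) = p := by
  induction p using Path.Homotopic.Quotient.ind with | mk p =>
  rfl

theorem relabel_straight (a : κ ↪ Fin n) (r : ι ↪ κ) :
    (straight a).relabel r = straight (r.trans a) := rfl

end Strands

/-! ### The braid group -/

/-- A braid on `n` strands, up to isotopy: the strand which starts at the left-hand node `i` ends
at the right-hand node `perm i`. -/
structure Braid (n : ℕ) : Type where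
  perm : Equiv.Perm (Fin n)
  strands : Strands (Function.Embedding.refl (Fin n)) perm.toEmbedding

namespace Braid

variable {n : ℕ}

/-- Multiplication of braids is concatenation, from left to right. -/
instance : Mul (Braid n) where
  mul x y := ⟨x.perm.trans y.perm, x.strands.comp (y.strands.relabel x.perm.toEmbedding)⟩

instance : One (Braid n) where
  one := ⟨Equiv.refl _, Strands.straight _⟩

/-- The inverse of a braid is its reflection. -/
instance : Inv (Braid n) where
  inv x := ⟨x.perm.symm, (x.strands.reflect.relabel x.perm.symm.toEmbedding).cast
    (by ext i; simp) rfl⟩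

theorem mul_def (x y : Braid n) : x * y =
    ⟨x.perm.trans y.perm, x.strands.comp (y.strands.relabel x.perm.toEmbedding)⟩ := rfl

theorem one_def : (1 : Braid n) = ⟨Equiv.refl _, Strands.straight _⟩ := rfl

theorem mul_assoc' (x y z : Braid n) : x * y * z = x * (y * z) := by
  refine congrArg (fun s => (⟨(x.perm.trans y.perm).trans z.perm, s⟩ : Braid n)) ?_
  refine (Strands.comp_assoc x.strands (y.strands.relabel x.perm.toEmbedding)
    (z.strands.relabel (x.perm.toEmbedding.trans y.perm.toEmbedding))).trans ?_
  refine congrArg (Strands.comp x.strands) ?_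
  exact ((Strands.relabel_comp y.strands (z.strands.relabel y.perm.toEmbedding)
    x.perm.toEmbedding).trans
      (congrArg (Strands.comp _) (Strands.relabel_relabel z.strands _ _))).symm

theorem one_mul' (x : Braid n) : 1 * x = x := by
  refine congrArg (fun s => (⟨x.perm, s⟩ : Braid n)) ?_
  exact (Strands.straight_comp _).trans (Strands.relabel_refl x.strands)

theorem mul_one' (x : Braid n) : x * 1 = x :=
  congrArg (fun s => (⟨x.perm, s⟩ : Braid n)) (Strands.comp_straight x.strands)

theorem inv_mul' (x : Braid n) : x⁻¹ * x = 1 := by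
  have key : ∀ (e : Fin n ↪ Fin n) (f : Equiv.Perm (Fin n)) (hf : f = Equiv.refl _)
      (h : e = f.toEmbedding) (h1 : Function.Embedding.refl _ = e)
      (p : Strands e f.toEmbedding) (_ : p = (Strands.straight e).cast rfl h.symm),
      (⟨f, p.cast h1 rfl⟩ : Braid n) = 1 := by
    intro e f hf h h1 p hp
    subst hf
    subst h1
    subst hp
    rw [one_def]
    congr 1
  refine Eq.trans (congrArg (fun s => (⟨x.perm.symm.trans x.perm, s⟩ : Braid n))
    (Strands.cast_comp (x.strands.reflect.relabel x.perm.symm.toEmbedding) (by ext i; simp)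
      (x.strands.relabel x.perm.symm.toEmbedding))) ?_
  refine key (x.perm.symm.toEmbedding.trans x.perm.toEmbedding) (x.perm.symm.trans x.perm)
    (by simp) rfl (by ext i; simp)
    ((x.strands.reflect.relabel x.perm.symm.toEmbedding).comp
      (x.strands.relabel x.perm.symm.toEmbedding)) ?_
  exact (Strands.relabel_comp x.strands.reflect x.strands x.perm.symm.toEmbedding).symm.trans
    (congrArg (fun s => Strands.relabel s x.perm.symm.toEmbedding)
      (Strands.reflect_comp x.strands))

instance : Group (Braid n) where
  mul_assoc := mul_assoc'
  one_mul := one_mul'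
  mul_one := mul_one'
  inv_mul_cancel := inv_mul'

/-- The action of the braid group on `G ^ n` by permuting the factors. -/
def permAction (n : ℕ) (G : Type u) [Group G] : Braid n →* MulAut (Fin n → G) where
  toFun x :=
    { toFun := fun g i => g (x.perm i)
      invFun := fun g i => g (x.perm.symm i)
      left_inv := fun g => by funext i; simp
      right_inv := fun g => by funext i; simp
      map_mul' := fun _ _ => rfl }
  map_one' := rfl
  map_mul' _ _ := rfl

end Braid

/-- The semi-direct product `G ^ n ⋊ B_n`, where `B_n` permutes the factors of `G ^ n`. -/
abbrev BraidedWreath (n : ℕ) (G : Type u) [Group G] : Type u :=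
  (Fin n → G) ⋊[Braid.permAction n G] Braid n

/-! ### Braided rook diagrams with labels in a group -/

/-- A `G`-braided rook `n`-diagram, up to isotopy: `dom` is the set of the left-hand nodes that are
connected to a right-hand node, `tgt i` is the right-hand node connected to `i`, `strands` are the
braided strands and `label i` is the label of the strand that starts at `i`. -/
structure BraidedRookDiagram (n : ℕ) (G : Type u) : Type u where
  dom : Set (Fin n)
  tgt : dom ↪ Fin n
  strands : Strands (Function.Embedding.subtype (· ∈ dom)) tgt
  label : dom → G

namespace BraidedRookDiagram

variable {n : ℕ} {G : Type u}

/-- All the nodes are connected: the diagram has no missing edges. -/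
def IsFull (x : BraidedRookDiagram n G) : Prop := x.dom = Set.univ

/-- The left-hand nodes which are connected to a right-hand node in the composite of `x` and `y`. -/
def compDom (x y : BraidedRookDiagram n G) : Set (Fin n) :=
  {i | ∃ h : i ∈ x.dom, x.tgt ⟨i, h⟩ ∈ y.dom}

/-- The strand of `x` used by the strand of the composite that starts at a given node. -/
def compFst (x y : BraidedRookDiagram n G) : compDom x y ↪ x.dom :=
  ⟨fun i => ⟨i.1, i.2.1⟩, fun i j h => Subtype.ext (by simpa using h)⟩

/-- The strand of `y` used by the strand of the composite that starts at a given node. -/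
def compSnd (x y : BraidedRookDiagram n G) : compDom x y ↪ y.dom :=
  ⟨fun i => ⟨x.tgt ⟨i.1, i.2.1⟩, i.2.2⟩, fun i j h => by
    have h1 : x.tgt ⟨i.1, i.2.1⟩ = x.tgt ⟨j.1, j.2.1⟩ := congrArg Subtype.val h
    have h2 := x.tgt.injective h1
    exact Subtype.ext (by simpa using h2)⟩

/-- Composition of diagrams: place `x` to the left of `y`, identify the right-hand nodes of `x` with
the left-hand nodes of `y`, delete the strands that do not run from the left to the right, and
multiply labels from left to right. -/
instance [Mul G] : Mul (BraidedRookDiagram n G) where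
  mul x y :=
    { dom := compDom x y
      tgt := (compSnd x y).trans y.tgt
      strands := (x.strands.relabel (compFst x y)).comp (y.strands.relabel (compSnd x y))
      label := fun i => x.label (compFst x y i) * y.label (compSnd x y i) }

/-- The identity diagram. -/
instance [One G] : One (BraidedRookDiagram n G) where
  one :=
    { dom := Set.univ
      tgt := Function.Embedding.subtype _
      strands := Strands.straight _
      label := fun _ => 1 }

/-- The number of contractible components in the concatenation of `x` and `y` that are connected
neither to a left-hand node of `x` nor to a right-hand node of `y`: these are the nodes in the
middle which are isolated both in `x` and in `y`. -/
def contractible (x y : BraidedRookDiagram n G) : ℕ :=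
  Set.ncard {j : Fin n | j ∉ Set.range x.tgt ∧ j ∉ y.dom}

/-- The restriction of a diagram to part of its strands. -/
def restrict (x : BraidedRookDiagram n G) (S : Set (Fin n)) (h : S ⊆ x.dom) :
    BraidedRookDiagram n G where
  dom := S
  tgt := (Set.embeddingOfSubset S x.dom h).trans x.tgt
  strands := x.strands.relabel (Set.embeddingOfSubset S x.dom h)
  label := fun i => x.label (Set.embeddingOfSubset S x.dom h i)

theorem restrict_eq (x : BraidedRookDiagram n G) (S : Set (Fin n)) (h : S ⊆ x.dom)
    (h' : S = x.dom) : x.restrict S h = x := by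
  cases h'
  exact congrArg (fun s => (⟨x.dom, x.tgt, s, x.label⟩ : BraidedRookDiagram n G))
    (Strands.relabel_refl x.strands)

theorem mk_congr {S : Set (Fin n)} {t : S ↪ Fin n}
    {s s' : Strands (Function.Embedding.subtype (· ∈ S)) t} {l l' : S → G}
    (hs : s = s') (hl : l = l') :
    (⟨S, t, s, l⟩ : BraidedRookDiagram n G) = ⟨S, t, s', l'⟩ := by
  rw [hs, hl]

theorem one_mul' [Group G] (x : BraidedRookDiagram n G) : 1 * x = x := by
  have hS : compDom 1 x = x.dom := by
    ext i
    exact ⟨fun h => h.2, fun h => ⟨Set.mem_univ i, h⟩⟩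
  refine Eq.trans ?_ (x.restrict_eq (compDom 1 x) hS.le hS)
  exact mk_congr (Strands.straight_comp _) (funext fun i => one_mul _)

theorem mul_one' [Group G] (x : BraidedRookDiagram n G) : x * 1 = x := by
  have hS : compDom x 1 = x.dom := by
    ext i
    exact ⟨fun h => h.1, fun h => ⟨h, Set.mem_univ _⟩⟩
  refine Eq.trans ?_ (x.restrict_eq (compDom x 1) hS.le hS)
  exact mk_congr (Strands.comp_straight _) (funext fun i => mul_one _)

/-- The composite of three diagrams, where the set of the strands of the composite is given. -/
def triple [Mul G] (x y z : BraidedRookDiagram n G) (S : Set (Fin n)) (h1 : ∀ i ∈ S, i ∈ x.dom)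
    (h2 : ∀ i (hi : i ∈ S), x.tgt ⟨i, h1 i hi⟩ ∈ y.dom)
    (h3 : ∀ i (hi : i ∈ S), y.tgt ⟨x.tgt ⟨i, h1 i hi⟩, h2 i hi⟩ ∈ z.dom) :
    BraidedRookDiagram n G :=
  let r1 : S ↪ x.dom := ⟨fun i => ⟨i.1, h1 i.1 i.2⟩, fun i j h => Subtype.ext (by simpa using h)⟩
  let r2 : S ↪ y.dom := ⟨fun i => ⟨x.tgt (r1 i), h2 i.1 i.2⟩, fun i j h =>
    r1.injective (x.tgt.injective (congrArg Subtype.val h))⟩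
  let r3 : S ↪ z.dom := ⟨fun i => ⟨y.tgt (r2 i), h3 i.1 i.2⟩, fun i j h =>
    r2.injective (y.tgt.injective (congrArg Subtype.val h))⟩
  { dom := S
    tgt := r3.trans z.tgt
    strands := (x.strands.relabel r1).comp ((y.strands.relabel r2).comp (z.strands.relabel r3))
    label := fun i => x.label (r1 i) * (y.label (r2 i) * z.label (r3 i)) }

theorem triple_congr [Mul G] (x y z : BraidedRookDiagram n G) {S S' : Set (Fin n)} (h : S = S')
    (h1 h2 h3 h1' h2' h3') : triple x y z S h1 h2 h3 = triple x y z S' h1' h2' h3' := by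
  cases h; rfl

theorem mul_assoc' [Group G] (x y z : BraidedRookDiagram n G) : x * y * z = x * (y * z) := by
  have hS : compDom (x * y) z = compDom x (y * z) := by
    ext i
    constructor
    · rintro ⟨⟨a, b⟩, c⟩
      exact ⟨a, b, c⟩
    · rintro ⟨a, b, c⟩
      exact ⟨⟨a, b⟩, c⟩
  have hl : x * y * z = triple x y z (compDom (x * y) z) (fun i hi => hi.1.1)
      (fun i hi => hi.1.2) (fun i hi => hi.2) := by
    refine mk_congr ?_ (funext fun i => mul_assoc _ _ _)
    refine Eq.trans (congrArg (fun s => Strands.comp s (z.strands.relabel (compSnd (x * y) z)))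
      ((Strands.relabel_comp (x.strands.relabel (compFst x y)) (y.strands.relabel (compSnd x y))
        (compFst (x * y) z)))) ?_
    refine Eq.trans (Strands.comp_assoc _ _ _) ?_
    exact congrArg₂ Strands.comp (Strands.relabel_relabel x.strands _ _)
      (congrArg₂ Strands.comp (Strands.relabel_relabel y.strands _ _) rfl)
  have hr : x * (y * z) = triple x y z (compDom x (y * z)) (fun i hi => hi.1)
      (fun i hi => hi.2.1) (fun i hi => hi.2.2) := by
    refine mk_congr ?_ rfl
    refine Eq.trans (congrArg (fun s => Strands.comp (x.strands.relabel (compFst x (y * z))) s)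
      ((Strands.relabel_comp (y.strands.relabel (compFst y z)) (z.strands.relabel (compSnd y z))
        (compSnd x (y * z))))) ?_
    exact congrArg₂ Strands.comp rfl (congrArg₂ Strands.comp
      (Strands.relabel_relabel y.strands _ _) (Strands.relabel_relabel z.strands _ _))
  rw [hl, hr]
  exact triple_congr x y z hS _ _ _ _ _ _

instance [Group G] : Monoid (BraidedRookDiagram n G) where
  mul_assoc := mul_assoc'
  one_mul := one_mul'
  mul_one := mul_one'

theorem mem_dom_mul [Group G] (x y : BraidedRookDiagram n G) (i : Fin n) :
    i ∈ (x * y).dom ↔ ∃ h : i ∈ x.dom, x.tgt ⟨i, h⟩ ∈ y.dom := Iff.rfl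

theorem mem_range_mul [Group G] (x y : BraidedRookDiagram n G) (j : Fin n) :
    j ∈ Set.range (x * y).tgt ↔ ∃ i, ∃ h : i ∈ y.dom, i ∈ Set.range x.tgt ∧ y.tgt ⟨i, h⟩ = j := by
  constructor
  · rintro ⟨⟨i, h1, h2⟩, rfl⟩
    exact ⟨x.tgt ⟨i, h1⟩, h2, ⟨_, rfl⟩, rfl⟩
  · rintro ⟨_, h, ⟨⟨i, h1⟩, rfl⟩, rfl⟩
    exact ⟨⟨i, h1, h⟩, rfl⟩

theorem contractible_one_left [Group G] (x : BraidedRookDiagram n G) : contractible 1 x = 0 := by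
  rw [contractible, Set.ncard_eq_zero, Set.eq_empty_iff_forall_notMem]
  rintro j ⟨h, -⟩
  exact h ⟨⟨j, Set.mem_univ j⟩, rfl⟩

theorem contractible_one_right [Group G] (x : BraidedRookDiagram n G) : contractible x 1 = 0 := by
  rw [contractible, Set.ncard_eq_zero, Set.eq_empty_iff_forall_notMem]
  rintro j ⟨-, h⟩
  exact h (Set.mem_univ j)

theorem contractible_assoc [Group G] (x y z : BraidedRookDiagram n G) :
    contractible x y + contractible (x * y) z = contractible y z + contractible x (y * z) := by
  -- the nodes isolated in `x` whose strand in `y` ends at a node isolated in `z`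
  let A : Set y.dom := {i | i.1 ∉ Set.range x.tgt ∧ y.tgt i ∉ z.dom}
  have hl : contractible (x * y) z = contractible y z + A.ncard := by
    have e : {j : Fin n | j ∉ Set.range (x * y).tgt ∧ j ∉ z.dom} =
        {j : Fin n | j ∉ Set.range y.tgt ∧ j ∉ z.dom} ∪ y.tgt '' A := by
      ext j
      simp only [Set.mem_ofPred_eq, Set.mem_union, Set.mem_image, mem_range_mul]
      constructor
      · rintro ⟨h1, h2⟩
        by_cases hj : j ∈ Set.range y.tgt
        · obtain ⟨i, rfl⟩ := hj
          exact Or.inr ⟨i, ⟨fun h => h1 ⟨i.1, i.2, h, rfl⟩, h2⟩, rfl⟩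
        · exact Or.inl ⟨hj, h2⟩
      · rintro (⟨h1, h2⟩ | ⟨i, ⟨h1, h2⟩, rfl⟩)
        · exact ⟨fun ⟨i, hi, _, h⟩ => h1 ⟨⟨i, hi⟩, h⟩, h2⟩
        · refine ⟨fun ⟨i', hi', h3, h4⟩ => h1 ?_, h2⟩
          rw [← y.tgt.injective h4]
          exact h3
    rw [contractible, e, Set.ncard_union_eq, Set.ncard_image_of_injective _ y.tgt.injective]
    · rfl
    · rw [Set.disjoint_left]
      rintro _ ⟨h, -⟩ ⟨i, -, rfl⟩
      exact h ⟨i, rfl⟩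
  have hr : contractible x (y * z) = contractible x y + A.ncard := by
    have e : {j : Fin n | j ∉ Set.range x.tgt ∧ j ∉ (y * z).dom} =
        {j : Fin n | j ∉ Set.range x.tgt ∧ j ∉ y.dom} ∪ Subtype.val '' A := by
      ext j
      simp only [Set.mem_ofPred_eq, Set.mem_union, Set.mem_image, mem_dom_mul]
      constructor
      · rintro ⟨h1, h2⟩
        by_cases hj : j ∈ y.dom
        · exact Or.inr ⟨⟨j, hj⟩, ⟨h1, fun h => h2 ⟨hj, h⟩⟩, rfl⟩
        · exact Or.inl ⟨h1, hj⟩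
      · rintro (⟨h1, h2⟩ | ⟨i, ⟨h1, h2⟩, rfl⟩)
        · exact ⟨h1, fun h => h2 h.1⟩
        · exact ⟨h1, fun ⟨_, h⟩ => h2 h⟩
    rw [contractible, e, Set.ncard_union_eq, Set.ncard_image_of_injective _ Subtype.val_injective]
    · rfl
    · rw [Set.disjoint_left]
      rintro _ ⟨-, h⟩ ⟨i, -, rfl⟩
      exact h i.2
  rw [hl, hr]
  ring

theorem isFull_mul [Group G] (x y : BraidedRookDiagram n G) :
    (x * y).IsFull ↔ x.IsFull ∧ y.IsFull := by
  simp only [IsFull, Set.eq_univ_iff_forall, mem_dom_mul]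
  constructor
  · intro h
    refine ⟨fun i => (h i).1, fun j => ?_⟩
    have hinj : Function.Injective (fun i => x.tgt ⟨i, (h i).1⟩) := fun a b hab => by
      simpa using x.tgt.injective hab
    obtain ⟨i, rfl⟩ := Finite.surjective_of_injective hinj j
    exact (h i).2
  · rintro ⟨h1, h2⟩ i
    exact ⟨h1 i, h2 _⟩

theorem contractible_of_isFull [Group G] (x y : BraidedRookDiagram n G) (h : y.IsFull) :
    contractible x y = 0 := by
  rw [contractible, Set.ncard_eq_zero, Set.eq_empty_iff_forall_notMem]
  rintro j ⟨-, hj⟩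
  rw [h] at hj
  exact hj (Set.mem_univ j)

end BraidedRookDiagram

/-! ### The `G`-braided rook algebra -/

/-- The `G`-braided rook algebra with parameter `ε`: formal `k`-linear combinations of `G`-braided
rook `n`-diagrams. -/
def BraidedRookAlgebra (n : ℕ) (G : Type u) {k : Type u} [CommRing k] (_ε : k) : Type u :=
  BraidedRookDiagram n G →₀ k

namespace BraidedRookAlgebra

open BraidedRookDiagram

variable {n : ℕ} {G k : Type u} [CommRing k] {ε : k}

instance : AddCommGroup (BraidedRookAlgebra n G ε) :=
  inferInstanceAs (AddCommGroup (BraidedRookDiagram n G →₀ k))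

instance : Module k (BraidedRookAlgebra n G ε) :=
  inferInstanceAs (Module k (BraidedRookDiagram n G →₀ k))

/-- The multiple `a • x` of a diagram `x`. -/
def single (ε : k) (x : BraidedRookDiagram n G) (a : k) : BraidedRookAlgebra n G ε :=
  Finsupp.single x a

theorem smul_single (c : k) (x : BraidedRookDiagram n G) (a : k) :
    c • single ε x a = single ε x (c * a) :=
  Finsupp.smul_single' c x a

theorem induction_on {p : BraidedRookAlgebra n G ε → Prop} (a : BraidedRookAlgebra n G ε)
    (h0 : p 0) (hadd : ∀ a b, p a → p b → p (a + b)) (hs : ∀ x c, p (single ε x c)) : p a :=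
  Finsupp.induction_linear a h0 hadd hs

/-- The bilinear extension of the composition of diagrams, where each contractible component is
replaced with a factor `ε`. -/
def mulHom [Group G] :
    BraidedRookAlgebra n G ε →ₗ[k] BraidedRookAlgebra n G ε →ₗ[k] BraidedRookAlgebra n G ε :=
  Finsupp.lsum k fun x => LinearMap.toSpanSingleton k _ <|
    Finsupp.lsum k fun y => LinearMap.toSpanSingleton k _ <|
      single ε (x * y) (ε ^ contractible x y)

variable [Group G]

instance : Mul (BraidedRookAlgebra n G ε) := ⟨fun a b => mulHom a b⟩

instance : One (BraidedRookAlgebra n G ε) := ⟨single ε 1 1⟩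

theorem mul_def (a b : BraidedRookAlgebra n G ε) : a * b = mulHom a b := rfl

theorem one_def : (1 : BraidedRookAlgebra n G ε) = single ε 1 1 := rfl

theorem single_mul_single (x y : BraidedRookDiagram n G) (a b : k) :
    single ε x a * single ε y b = single ε (x * y) (a * b * ε ^ contractible x y) := by
  have h1 : (mulHom (single ε x a) : BraidedRookAlgebra n G ε →ₗ[k] BraidedRookAlgebra n G ε) =
      a • Finsupp.lsum k fun y => LinearMap.toSpanSingleton k (BraidedRookAlgebra n G ε) <|
        single ε (x * y) (ε ^ contractible x y) := by
    refine (Finsupp.lsum_single k _ x a).trans ?_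
    rfl
  have h2 : (Finsupp.lsum k fun y => LinearMap.toSpanSingleton k (BraidedRookAlgebra n G ε) <|
      single ε (x * y) (ε ^ contractible x y)) (single ε y b) =
      b • single ε (x * y) (ε ^ contractible x y) := by
    refine (Finsupp.lsum_single k _ y b).trans ?_
    rfl
  rw [mul_def, h1]
  refine (congrArg (fun t => a • t) h2).trans ?_
  rw [smul_single, smul_single, mul_assoc]

theorem zero_mul' (a : BraidedRookAlgebra n G ε) : 0 * a = 0 := by
  rw [mul_def, map_zero]; rfl

theorem mul_zero' (a : BraidedRookAlgebra n G ε) : a * 0 = 0 := by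
  rw [mul_def, map_zero]

theorem add_mul' (a b c : BraidedRookAlgebra n G ε) : (a + b) * c = a * c + b * c := by
  rw [mul_def, map_add]; rfl

theorem mul_add' (a b c : BraidedRookAlgebra n G ε) : a * (b + c) = a * b + a * c := by
  rw [mul_def, map_add]; rfl

theorem one_mul' (a : BraidedRookAlgebra n G ε) : 1 * a = a := by
  induction a using induction_on with
  | h0 => exact mul_zero' _
  | hadd a b ha hb => rw [mul_add', ha, hb]
  | hs x c => rw [one_def, single_mul_single, contractible_one_left, one_mul]; simp

theorem mul_one' (a : BraidedRookAlgebra n G ε) : a * 1 = a := by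
  induction a using induction_on with
  | h0 => exact zero_mul' _
  | hadd a b ha hb => rw [add_mul', ha, hb]
  | hs x c => rw [one_def, single_mul_single, contractible_one_right, mul_one]; simp

theorem mul_assoc' (a b c : BraidedRookAlgebra n G ε) : a * b * c = a * (b * c) := by
  induction a using induction_on with
  | h0 => simp only [zero_mul']
  | hadd a b ha hb => simp only [add_mul', ha, hb]
  | hs x r =>
    induction b using induction_on with
    | h0 => simp only [zero_mul', mul_zero']
    | hadd a b ha hb => simp only [add_mul', mul_add', ha, hb]
    | hs y s =>
      induction c using induction_on with
      | h0 => simp only [mul_zero']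
      | hadd a b ha hb => simp only [mul_add', ha, hb]
      | hs z t =>
        simp only [single_mul_single, mul_assoc x y z]
        congr 1
        have h : ε ^ contractible x y * ε ^ contractible (x * y) z =
            ε ^ contractible y z * ε ^ contractible x (y * z) := by
          rw [← pow_add, ← pow_add, contractible_assoc]
        linear_combination (r * s * t) * h

instance : Ring (BraidedRookAlgebra n G ε) where
  left_distrib := mul_add'
  right_distrib := add_mul'
  zero_mul := zero_mul'
  mul_zero := mul_zero'
  mul_assoc := mul_assoc'
  one_mul := one_mul'
  mul_one := mul_one'
  neg_add_cancel := neg_add_cancel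
  zsmul := fun m a => m • a
  nsmul := fun m a => m • a
  zsmul_zero' := zero_zsmul
  zsmul_succ' := fun m a => by
    rw [Nat.succ_eq_add_one, Int.natCast_add, Int.natCast_one, add_zsmul, one_zsmul]
  zsmul_neg' := fun m a => by
    rw [Int.negSucc_eq, neg_zsmul]; rfl
  nsmul_zero := zero_nsmul
  nsmul_succ := fun m a => succ_nsmul a m
  sub_eq_add_neg := sub_eq_add_neg

instance : Algebra k (BraidedRookAlgebra n G ε) :=
  Algebra.ofModule
    (fun r a b => by simp only [mul_def, map_smul, LinearMap.smul_apply])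
    (fun r a b => by simp only [mul_def, map_smul])

open Classical in
/-- The linear map which maps each diagram with no missing edges to `1` and all the other diagrams
to `0`. -/
def fullSum (n : ℕ) (G : Type u) [Group G] {k : Type u} [CommRing k] (ε : k) :
    BraidedRookAlgebra n G ε →ₗ[k] k :=
  Finsupp.lsum k fun x : BraidedRookDiagram n G => if x.IsFull then LinearMap.id else 0

open Classical in
theorem fullSum_single (x : BraidedRookDiagram n G) (c : k) :
    fullSum n G ε (single ε x c) = if x.IsFull then c else 0 := by
  refine (Finsupp.lsum_single k _ x c).trans ?_
  split_ifs <;> rfl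

theorem fullSum_one : fullSum n G ε 1 = 1 := by
  rw [one_def, fullSum_single]
  exact if_pos rfl

theorem fullSum_mul (a b : BraidedRookAlgebra n G ε) :
    fullSum n G ε (a * b) = fullSum n G ε a * fullSum n G ε b := by
  induction a using induction_on with
  | h0 => rw [zero_mul, map_zero, zero_mul]
  | hadd a b ha hb => rw [add_mul, map_add, map_add, ha, hb, add_mul]
  | hs x r =>
    induction b using induction_on with
    | h0 => rw [mul_zero, map_zero, mul_zero]
    | hadd a b ha hb => rw [mul_add, map_add, map_add, ha, hb, mul_add]
    | hs y s =>
      rw [single_mul_single, fullSum_single, fullSum_single, fullSum_single]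
      by_cases hx : x.IsFull <;> by_cases hy : y.IsFull
      · rw [if_pos ((isFull_mul x y).2 ⟨hx, hy⟩), if_pos hx, if_pos hy,
          contractible_of_isFull x y hy, pow_zero, mul_one]
      · rw [if_neg (fun h => hy ((isFull_mul x y).1 h).2), if_neg hy, mul_zero]
      · rw [if_neg (fun h => hx ((isFull_mul x y).1 h).1), if_neg hx, zero_mul]
      · rw [if_neg (fun h => hx ((isFull_mul x y).1 h).1), if_neg hx, zero_mul]

/-- The augmentation through which the algebra acts on the trivial module: diagrams with no missing
edges act as `1`, all the other diagrams act as `0`. -/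
def augmentation (n : ℕ) (G : Type u) [Group G] {k : Type u} [CommRing k] (ε : k) :
    BraidedRookAlgebra n G ε →ₐ[k] k :=
  AlgHom.ofLinearMap (fullSum n G ε) fullSum_one fullSum_mul

end BraidedRookAlgebra

/-! ### Tor over an algebra that need not be commutative -/

section Tor

variable (k : Type u) [CommRing k] {A : Type u} [Ring A] [Algebra k A]

/-- A left `A`-module as a `k`-module. -/
abbrev leftRestrict (N : ModuleCat.{u} A) : ModuleCat.{u} k :=
  (ModuleCat.restrictScalars (algebraMap k A)).obj N

/-- A right `A`-module as a `k`-module. -/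
abbrev rightRestrict (M : ModuleCat.{u} Aᵐᵒᵖ) : ModuleCat.{u} k :=
  (ModuleCat.restrictScalars (algebraMap k Aᵐᵒᵖ)).obj M

/-- The relations `(m a) ⊗ n = m ⊗ (a n)`. -/
def balancedRel (M : ModuleCat.{u} Aᵐᵒᵖ) (N : ModuleCat.{u} A) :
    Submodule k (rightRestrict k M ⊗[k] leftRestrict k N) :=
  Submodule.span k {t | ∃ (m : M) (a : A) (x : N),
    t = (show rightRestrict k M from MulOpposite.op a • m) ⊗ₜ[k] (show leftRestrict k N from x) -
      (show rightRestrict k M from m) ⊗ₜ[k] (show leftRestrict k N from a • x)}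

/-- The tensor product `M ⊗_A N` of a right module and a left module over `A`, as a `k`-module. -/
abbrev BalancedTensor (M : ModuleCat.{u} Aᵐᵒᵖ) (N : ModuleCat.{u} A) : Type u :=
  (rightRestrict k M ⊗[k] leftRestrict k N) ⧸ balancedRel k M N

/-- The map `m ⊗ n ↦ m ⊗ f n`. -/
def balancedMap (M : ModuleCat.{u} Aᵐᵒᵖ) {N N' : ModuleCat.{u} A} (f : N ⟶ N') :
    BalancedTensor k M N →ₗ[k] BalancedTensor k M N' :=
  Submodule.mapQ _ _ (LinearMap.lTensor (rightRestrict k M)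
      ((ModuleCat.restrictScalars (algebraMap k A)).map f).hom) <| by
    rw [balancedRel, Submodule.span_le]
    rintro _ ⟨m, a, x, rfl⟩
    refine Submodule.subset_span ⟨m, a, f.hom x, ?_⟩
    rw [map_sub, LinearMap.lTensor_tmul, LinearMap.lTensor_tmul]
    congr 2
    exact f.hom.map_smul a x

theorem balancedMap_mk (M : ModuleCat.{u} Aᵐᵒᵖ) {N N' : ModuleCat.{u} A} (f : N ⟶ N')
    (t : rightRestrict k M ⊗[k] leftRestrict k N) :
    balancedMap k M f (Submodule.Quotient.mk t) = Submodule.Quotient.mk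
      (LinearMap.lTensor (rightRestrict k M)
        ((ModuleCat.restrictScalars (algebraMap k A)).map f).hom t) := rfl

theorem balancedMap_id (M : ModuleCat.{u} Aᵐᵒᵖ) (N : ModuleCat.{u} A) :
    balancedMap k M (𝟙 N) = LinearMap.id := by
  refine LinearMap.ext fun t => ?_
  obtain ⟨t, rfl⟩ := Submodule.Quotient.mk_surjective _ t
  rw [balancedMap_mk, CategoryTheory.Functor.map_id, ModuleCat.hom_id, LinearMap.lTensor_id]
  rfl

theorem balancedMap_comp (M : ModuleCat.{u} Aᵐᵒᵖ) {N N' N'' : ModuleCat.{u} A} (f : N ⟶ N')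
    (g : N' ⟶ N'') :
    balancedMap k M (f ≫ g) = (balancedMap k M g).comp (balancedMap k M f) := by
  refine LinearMap.ext fun t => ?_
  obtain ⟨t, rfl⟩ := Submodule.Quotient.mk_surjective _ t
  rw [balancedMap_mk, CategoryTheory.Functor.map_comp, ModuleCat.hom_comp, LinearMap.lTensor_comp]
  rfl

theorem balancedMap_add (M : ModuleCat.{u} Aᵐᵒᵖ) {N N' : ModuleCat.{u} A} (f g : N ⟶ N') :
    balancedMap k M (f + g) = balancedMap k M f + balancedMap k M g := by
  refine LinearMap.ext fun t => ?_
  obtain ⟨t, rfl⟩ := Submodule.Quotient.mk_surjective _ t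
  rw [balancedMap_mk, CategoryTheory.Functor.map_add, ModuleCat.hom_add, LinearMap.lTensor_add]
  rfl

/-- The functor `M ⊗_A -` from left `A`-modules to `k`-modules, for a right `A`-module `M`. -/
def balancedTensor (M : ModuleCat.{u} Aᵐᵒᵖ) : ModuleCat.{u} A ⥤ ModuleCat.{u} k where
  obj N := ModuleCat.of k (BalancedTensor k M N)
  map f := ModuleCat.ofHom (balancedMap k M f)
  map_id N := by rw [balancedMap_id]; rfl
  map_comp f g := by rw [balancedMap_comp]; rfl

instance (M : ModuleCat.{u} Aᵐᵒᵖ) : (balancedTensor k M).Additive where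
  map_add {_ _ f g} := congrArg ModuleCat.ofHom (balancedMap_add k M f g)

/-- `Tor_i^A(M, N)` as a `k`-module, for a right module `M` and a left module `N` over the
`k`-algebra `A`: the left derived functors of `M ⊗_A -`, at `N`. -/
def torAlg (M : ModuleCat.{u} Aᵐᵒᵖ) (N : ModuleCat.{u} A) (i : ℕ) : ModuleCat.{u} k :=
  ((balancedTensor k M).leftDerived i).obj N

variable {k}

/-- The left module `k` over `A`, where `A` acts through `f : A → k`. -/
def leftTrivial (f : A →ₐ[k] k) : ModuleCat.{u} A :=
  (ModuleCat.restrictScalars f.toRingHom).obj (ModuleCat.of k k)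

/-- The right module `k` over `A`, where `A` acts through `f : A → k`. -/
def rightTrivial (f : A →ₐ[k] k) : ModuleCat.{u} Aᵐᵒᵖ :=
  (ModuleCat.restrictScalars (f.toRingHom.fromOpposite fun _ _ => Commute.all _ _)).obj
    (ModuleCat.of k k)

end Tor

/-- The augmentation of the group algebra, which maps all the elements of the group to `1`. -/
def groupAugmentation (k : Type u) [CommRing k] (H : Type u) [Group H] :
    MonoidAlgebra k H →ₐ[k] k :=
  MonoidAlgebra.lift k k H (1 : H →* k)

/-- `Tor_i` of the trivial module with itself, over the `G`-braided rook algebra. -/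
def torBraidedRook (n : ℕ) (G : Type u) [Group G] {k : Type u} [CommRing k] (ε : k) (i : ℕ) :
    ModuleCat.{u} k :=
  torAlg k (rightTrivial (BraidedRookAlgebra.augmentation n G ε))
    (leftTrivial (BraidedRookAlgebra.augmentation n G ε)) i

/-- `Tor_i` of the trivial module with itself, over the group algebra `k[H]`. -/
def torGroupAlgebra (k : Type u) [CommRing k] (H : Type u) [Group H] (i : ℕ) : ModuleCat.{u} k :=
  torAlg k (rightTrivial (groupAugmentation k H)) (leftTrivial (groupAugmentation k H)) i

end

noncomputable section

/-! Write `A` for the braided rook algebra, `B` for the group algebra of the wreath product and `I`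
for the span of the non-full diagrams. A product is full exactly when both factors are, and full
diagrams form a copy of the wreath product, so `I` is a two-sided ideal with `A/I ≅ B`, and the
augmentation of `A` factors through `B` (`toGroupAlgebra`, `groupAugmentation_comp_toGroupAlgebra`).

The point is that `B` is projective as a left `A`-module. Let `e_j` be the identity diagram with the
strand at `j` erased. If the right node `j` is isolated in `x`, then `x e_j = ε x` in `A`: no strand
is lost, and exactly one contractible component appears. Hence `x (1 - ε⁻¹ e_j) = 0`. Every non-full
diagram has an isolated right node, and isolated right nodes stay isolated after multiplication by
any `e_i`, so `e = ∏ (1 - ε⁻¹ e_j)` satisfies `I e = 0` while mapping to `1` in `B`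
(`mul_eraseProd_eq_zero`, `toGroupAlgebra_eraseProd`). Multiplying lifts by `e` then splits `A → B`
as left `A`-modules (`projective_of_annihilator`).

Consequently a projective resolution over `B` is also one over `A`. As `A → B` is surjective,
tensoring with the trivial module over `A` or over `B` gives the same complex, hence the same `Tor`
(`torTrivialIso`). Group homology enters by identifying the tensor product over `B` with
coinvariants (`torGroupAlgebraIso`). -/

/-! ### Projectivity and derived functors under restriction of scalars. -/

theorem Module.Projective.of_isScalarTower {A B P : Type*} [Ring A] [Ring B] [AddCommGroup P]
    [Module A B] [Module B P] [Module A P] [IsScalarTower A B P] [IsScalarTower A B B]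
    [Module.Projective A B] [Module.Projective B P] : Module.Projective A P := by
  obtain ⟨s, hs⟩ := Module.Projective.out (R := B) (P := P)
  -- `P` is a direct summand of `P →₀ B`, which over `A` is a direct sum of copies of the projective
  -- module `B`; `Π₀` is the form of the direct sum to which the instance applies.
  have hp : Module.Projective A (Π₀ _ : P, B) := inferInstance
  classical
  have hf : Module.Projective A (P →₀ B) :=
    Module.Projective.of_equiv' (finsuppLequivDFinsupp (ι := P) (M := B) A).symm
  -- `A` acts through the scalars `a • 1` of `B`, so the `B`-linear splitting is automatically
  -- `A`-linear.
  have hlin (a : A) (x : P) : a • x = (a • (1 : B)) • x := by rw [smul_assoc, one_smul]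
  have hlin' (a : A) (x : P →₀ B) : a • x = (a • (1 : B)) • x := by
    rw [smul_assoc, one_smul]
  refine Module.Projective.of_split (R := A) (M := P →₀ B)
    { toFun := s, map_add' := map_add s, map_smul' := fun a x => ?_ }
    { toFun := Finsupp.linearCombination B id, map_add' := map_add _, map_smul' := fun a x => ?_ }
    (LinearMap.ext hs)
  · simp only [RingHom.id_apply]
    rw [hlin, map_smul, ← hlin']
  · simp only [RingHom.id_apply]
    rw [hlin', map_smul, ← hlin]

/-- A ring `B` which is a quotient of `A` is projective as an `A`-module as soon as `1 : B` has a
preimage in `A` which annihilates the kernel from the right. -/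
theorem projective_of_annihilator {A B : Type u} [Ring A] [Ring B] (p : A →+* B)
    (hp : Function.Surjective p) (e : A) (he : p e = 1) (hker : ∀ a, p a = 0 → a * e = 0) :
    letI := Module.compHom B p
    Module.Projective A B := by
  let _ := Module.compHom B p
  -- Right multiplication by `e` depends only on the image in `B`, so `b ↦ (any lift of b) * e` is a
  -- well-defined `A`-linear section of `p`.
  have key {a b : A} (h : p a = p b) : a * e = b * e := by
    rw [← sub_eq_zero, ← sub_mul]
    exact hker _ (by rw [map_sub, h, sub_self])
  have hs := Function.surjInv_eq hp
  refine Module.Projective.of_split (R := A) (M := A)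
    { toFun := fun b => Function.surjInv hp b * e
      map_add' := fun x y => ?_
      map_smul' := fun a x => ?_ }
    { toFun := p
      map_add' := map_add p
      map_smul' := fun a x => map_mul p a x } ?_
  · rw [← add_mul]
    exact key (by rw [hs, map_add, hs, hs])
  · rw [RingHom.id_apply, smul_eq_mul, ← mul_assoc]
    exact key (by rw [hs, map_mul, hs]; rfl)
  · refine LinearMap.ext fun b => ?_
    change p (Function.surjInv hp b * e) = b
    rw [map_mul, he, mul_one, hs]

/-- Exactness depends only on the underlying functions, which restriction of scalars leaves alone.
This keeps a resolution over `B` exact over `A`. -/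
instance restrictScalars_preservesHomology {A B : Type u} [Ring A] [Ring B] (p : A →+* B) :
    (ModuleCat.restrictScalars.{u} p).PreservesHomology := by
  refine ((CategoryTheory.Functor.exact_tfae (ModuleCat.restrictScalars.{u} p)).out 1 2).mp ?_
  intro S h
  rw [CategoryTheory.ShortComplex.ShortExact.moduleCat_exact_iff_function_exact] at h ⊢
  exact h

theorem restrictScalars_preservesProjectiveObjects {A B : Type u} [Ring A] [Ring B] (p : A →+* B)
    (h : letI := Module.compHom B p; Module.Projective A B) :
    (ModuleCat.restrictScalars.{u} p).PreservesProjectiveObjects where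
  projective_obj {P} hP := by
    let _ := Module.compHom B p
    have : Module.Projective A B := h
    have : Module.Projective B P := (IsProjective.iff_projective P).2 hP
    let _ : Module A P := Module.compHom P p
    have : IsScalarTower A B P := ⟨fun a b x => mul_smul (p a) b x⟩
    have : IsScalarTower A B B := ⟨fun a b x => mul_assoc (p a) b x⟩
    have hP' : Module.Projective A P := Module.Projective.of_isScalarTower (B := B)
    exact (IsProjective.iff_projective (R := A) P).1 hP'

/-- Left derived functors can be computed after applying a functor which preserves homology and
projective objects. -/
def leftDerivedObjIso {C D E : Type*} [Category C] [Category D] [Category E] [Abelian C]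
    [Abelian D] [Abelian E] [HasProjectiveResolutions C] [HasProjectiveResolutions D]
    (F : C ⥤ D) [F.Additive] [F.PreservesProjectiveObjects] [F.PreservesHomology]
    (T : C ⥤ E) [T.Additive] (T' : D ⥤ E) [T'.Additive] (α : F ⋙ T' ≅ T) (X : C) (i : ℕ) :
    (T'.leftDerived i).obj (F.obj X) ≅ (T.leftDerived i).obj X :=
  let P := (HasProjectiveResolution.out (Z := X)).some
  -- `F` sends the resolution `P` of `X` to a projective resolution of `F.obj X`, and `α` identifies
  -- `T'` of the latter with `T` of `P`.
  (F.mapProjectiveResolution P).isoLeftDerivedObj T' i ≪≫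
    (HomologicalComplex.homologyFunctor E _ i).mapIso
      ((NatIso.mapHomologicalComplex α _).app P.complex) ≪≫
    (P.isoLeftDerivedObj T i).symm

/-! ### Change of rings for `Tor`. -/

section Tor

variable {k : Type u} [CommRing k] {A B : Type u} [Ring A] [Algebra k A] [Ring B] [Algebra k B]

/-- The tensor products over `A` and over a quotient `B` of `A` agree. -/
def balancedTensorEquiv (p : A →ₐ[k] B) (hp : Function.Surjective p)
    {M : ModuleCat.{u} Aᵐᵒᵖ} {N : ModuleCat.{u} A} {M' : ModuleCat.{u} Bᵐᵒᵖ} {N' : ModuleCat.{u} B}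
    (f : rightRestrict k M ≃ₗ[k] rightRestrict k M') (g : leftRestrict k N ≃ₗ[k] leftRestrict k N')
    (hf : ∀ (a : A) (m : M), f (show M from MulOpposite.op a • m) =
      (show M' from MulOpposite.op (p a) • (show M' from f m)))
    (hg : ∀ (a : A) (x : N), g (show N from a • x) = (show N' from p a • (show N' from g x))) :
    BalancedTensor k M N ≃ₗ[k] BalancedTensor k M' N' :=
  Submodule.Quotient.equiv _ _ (TensorProduct.congr f g) <| by
    rw [balancedRel, balancedRel, Submodule.map_span]
    congr 1
    ext t
    constructor
    · rintro ⟨_, ⟨m, a, x, rfl⟩, rfl⟩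
      refine ⟨f m, p a, g x, ?_⟩
      refine (map_sub (TensorProduct.congr f g) _ _).trans ?_
      exact congrArg₂ (· - ·) (congrArg (· ⊗ₜ[k] _) (hf a m)) (congrArg (_ ⊗ₜ[k] ·) (hg a x))
    · rintro ⟨m, b, x, rfl⟩
      -- Surjectivity of `p` is what makes every relation over `B` come from a relation over `A`.
      obtain ⟨a, rfl⟩ := hp b
      refine ⟨_, ⟨f.symm m, a, g.symm x, rfl⟩, ?_⟩
      refine (map_sub (TensorProduct.congr f g) _ _).trans ?_
      refine congrArg₂ (· - ·) (congrArg₂ (· ⊗ₜ[k] ·) ((hf a _).trans ?_) (g.apply_symm_apply x))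
        (congrArg₂ (· ⊗ₜ[k] ·) (f.apply_symm_apply m) ((hg a _).trans ?_))
      · exact congrArg (fun y : M' => MulOpposite.op (p a) • y) (f.apply_symm_apply m)
      · exact congrArg (fun y : N' => p a • y) (g.apply_symm_apply x)

/-- `Tor` of the trivial module over `A` and over a quotient `B` of `A` which is projective as an
`A`-module. -/
def torTrivialIso (p : A →ₐ[k] B) (hp : Function.Surjective p)
    (h : letI := Module.compHom B p.toRingHom; Module.Projective A B) (f : B →ₐ[k] k) (i : ℕ) :
    torAlg k (rightTrivial (f.comp p)) (leftTrivial (f.comp p)) i ≅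
      torAlg k (rightTrivial f) (leftTrivial f) i :=
  haveI := restrictScalars_preservesProjectiveObjects p.toRingHom h
  let F := ModuleCat.restrictScalars.{u} p.toRingHom
  let e : leftTrivial (f.comp p) ≅ F.obj (leftTrivial f) :=
    LinearEquiv.toModuleIso (m₁ := (leftTrivial (f.comp p)).isModule)
      (m₂ := (F.obj (leftTrivial f)).isModule)
      { toFun := fun x => x
        invFun := fun x => x
        map_add' := fun _ _ => rfl
        map_smul' := fun _ _ => rfl }
  let α : F ⋙ balancedTensor k (rightTrivial (f.comp p)) ≅ balancedTensor k (rightTrivial f) :=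
    NatIso.ofComponents (fun N => LinearEquiv.toModuleIso <|
      balancedTensorEquiv p hp (M := rightTrivial (f.comp p)) (N := F.obj N)
        (M' := rightTrivial f) (N' := N)
        { toFun := fun x => x
          invFun := fun x => x
          map_add' := fun _ _ => rfl
          -- The two `k`-structures come from `algebraMap k A` and `algebraMap k B`, and `p`
          -- intertwines these.
          map_smul' := fun c x => by
            change f (p (algebraMap k A c)) * (show k from x) =
              f (algebraMap k B c) * (show k from x)
            rw [p.commutes] }
        { toFun := fun x => x
          invFun := fun x => x
          map_add' := fun _ _ => rfl
          map_smul' := fun c x => by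
            change p (algebraMap k A c) • (show N from x) = algebraMap k B c • (show N from x)
            rw [p.commutes] }
        (fun _ _ => rfl) (fun _ _ => rfl)) <| fun {N N'} g => by
      refine ModuleCat.hom_ext (Submodule.linearMap_qext _ (TensorProduct.ext' fun x y => ?_))
      rfl
  ((balancedTensor k (rightTrivial (f.comp p))).leftDerived i).mapIso e ≪≫
    leftDerivedObjIso F (balancedTensor k (rightTrivial f)) _ α (leftTrivial f) i

end Tor

/-! ### `Tor` over a group algebra as group homology. -/

section GroupHomology

variable {k : Type u} [CommRing k] {H : Type u} [Group H]

instance : (Rep.toModuleMonoidAlgebra (k := k) (G := H)).Additive where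
  map_add := rfl

/-- The trivial representation, as a module over the group algebra. -/
def trivialModuleIso : leftTrivial (groupAugmentation k H) ≅
    Rep.toModuleMonoidAlgebra.obj (Rep.trivial k H k) :=
  LinearEquiv.toModuleIso (m₁ := (leftTrivial (groupAugmentation k H)).isModule)
    (m₂ := (Rep.toModuleMonoidAlgebra.obj (Rep.trivial k H k)).isModule)
    { toFun := fun x => x
      invFun := fun x => x
      map_add' := fun _ _ => rfl
      map_smul' := fun a x => by
        change groupAugmentation k H a * (show k from x) =
          MonoidAlgebra.lift k (k →ₗ[k] k) H (Representation.trivial k H k) a x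
        generalize (show k from x) = x
        induction a using MonoidAlgebra.induction_on with
        | of g => simp [groupAugmentation]
        | add a b ha hb => rw [map_add, map_add, add_mul, ha, hb, LinearMap.add_apply]
        | smul r a ha =>
          rw [map_smul, map_smul, smul_mul_assoc, ha, LinearMap.smul_apply] }

/-- Coinvariants of the tensor product with the trivial representation, as a tensor product over
the group algebra. -/
def coinvariantsTensorEquiv (X : Rep.{u} k H) :
    BalancedTensor k (rightTrivial (groupAugmentation k H)) (Rep.toModuleMonoidAlgebra.obj X) ≃ₗ[k]
      ((Rep.coinvariantsTensor k H).obj (Rep.trivial k H k)).obj X :=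
  let f : rightRestrict k (rightTrivial (groupAugmentation k H)) ≃ₗ[k] k :=
    { toFun := fun x => x
      invFun := fun x => x
      map_add' := fun _ _ => rfl
      map_smul' := fun c x => by
        change groupAugmentation k H (algebraMap k _ c) * (show k from x) = c * (show k from x)
        rw [AlgHom.commutes]; rfl }
  let g : leftRestrict k (Rep.toModuleMonoidAlgebra.obj X) ≃ₗ[k] X :=
    { toFun := fun x => x
      invFun := fun x => x
      map_add' := fun _ _ => rfl
      map_smul' := fun c x => by
        change MonoidAlgebra.lift k (X →ₗ[k] X) H X.ρ (algebraMap k _ c) (show X from x) =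
          c • (show X from x)
        rw [AlgHom.commutes]; rfl }
  Submodule.Quotient.equiv _ (Representation.Coinvariants.ker
      ((Rep.trivial k H k).ρ.tprod X.ρ)) (TensorProduct.congr f g) <| by
    rw [balancedRel, Representation.Coinvariants.ker, Submodule.map_span]
    refine le_antisymm (Submodule.span_le.2 ?_) (Submodule.span_le.2 ?_)
    · rintro _ ⟨_, ⟨m, a, x, rfl⟩, rfl⟩
      -- The balancing relation is linear in `a`; for a group element it is the negative of a
      -- coinvariants relation.
      have h : (groupAugmentation k H a * (show k from m)) ⊗ₜ[k] (show X from x) -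
          (show k from m) ⊗ₜ[k] (MonoidAlgebra.lift k (X →ₗ[k] X) H X.ρ a (show X from x)) ∈
          Submodule.span k (Set.range fun gv : H × (k ⊗[k] X) =>
            (Representation.trivial k H k).tprod X.ρ gv.1 gv.2 - gv.2) := by
        generalize (show k from m) = m
        generalize (show X from x) = x
        induction a using MonoidAlgebra.induction_on with
        | of g =>
          rw [← neg_mem_iff, neg_sub]
          refine Submodule.subset_span ⟨(g, m ⊗ₜ[k] x), ?_⟩
          simp [groupAugmentation]
        | add a b ha hb =>
          convert add_mem ha hb using 1
          simp only [map_add, add_mul, TensorProduct.add_tmul, LinearMap.add_apply,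
            TensorProduct.tmul_add]
          abel
        | smul r a ha =>
          convert Submodule.smul_mem _ r ha using 1
          simp only [map_smul, LinearMap.smul_apply, smul_sub, TensorProduct.tmul_smul,
            smul_mul_assoc, TensorProduct.smul_tmul']
      exact h
    · rintro _ ⟨⟨γ, t⟩, rfl⟩
      rw [SetLike.mem_coe]
      -- Conversely, balancing at the group element `γ` gives the coinvariants relation on pure
      -- tensors, and these span.
      have key (m : k) (x : X) : m ⊗ₜ[k] x - m ⊗ₜ[k] X.ρ γ x ∈
          Submodule.span k (TensorProduct.congr f g ''
            {t | ∃ (m : rightTrivial (groupAugmentation k H)) (a : MonoidAlgebra k H)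
              (x : Rep.toModuleMonoidAlgebra.obj X),
              t = (show rightRestrict k (rightTrivial (groupAugmentation k H)) from
                  MulOpposite.op a • m) ⊗ₜ[k]
                (show leftRestrict k (Rep.toModuleMonoidAlgebra.obj X) from x) -
                (show rightRestrict k (rightTrivial (groupAugmentation k H)) from m) ⊗ₜ[k]
                (show leftRestrict k (Rep.toModuleMonoidAlgebra.obj X) from a • x)}) := by
        refine Submodule.subset_span ⟨_, ⟨m, MonoidAlgebra.single γ 1, x, rfl⟩, ?_⟩
        have h : (groupAugmentation k H (MonoidAlgebra.single γ 1) * m) ⊗ₜ[k] x -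
            m ⊗ₜ[k] (MonoidAlgebra.lift k (X →ₗ[k] X) H X.ρ (MonoidAlgebra.single γ 1) x) =
            m ⊗ₜ[k] x - m ⊗ₜ[k] X.ρ γ x := by
          simp [groupAugmentation]
        exact h
      revert key
      generalize Submodule.span k (TensorProduct.congr f g '' _) = P
      intro key
      change (Representation.trivial k H k).tprod X.ρ γ t - t ∈ P
      induction t using TensorProduct.induction_on with
      | zero =>
        rw [map_zero, sub_zero]
        exact P.zero_mem
      | add s t hs ht =>
        rw [map_add, add_sub_add_comm]
        exact P.add_mem hs ht
      | tmul m x =>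
        rw [← neg_sub]
        exact P.neg_mem (key m x)

/-- Group homology with trivial coefficients is `Tor` over the group algebra. -/
def torGroupAlgebraIso (i : ℕ) :
    torGroupAlgebra k H i ≅ groupHomology (Rep.trivial k H k) i :=
  letI := Classical.decEq H
  let F := Rep.toModuleMonoidAlgebra (k := k) (G := H)
  let T := balancedTensor k (rightTrivial (groupAugmentation k H))
  let α : F ⋙ T ≅ (Rep.coinvariantsTensor k H).obj (Rep.trivial k H k) :=
    NatIso.ofComponents (fun X => (coinvariantsTensorEquiv X).toModuleIso) <| fun {X Y} g => by
      refine ModuleCat.hom_ext (Submodule.linearMap_qext _ (TensorProduct.ext' fun x y => ?_))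
      rfl
  (T.leftDerived i).mapIso trivialModuleIso ≪≫
    -- Representations and modules over the group algebra are equivalent categories, so `F`
    -- preserves projective objects and homology.
    leftDerivedObjIso F ((Rep.coinvariantsTensor k H).obj (Rep.trivial k H k)) T α _ i ≪≫
    (groupHomologyIsoTor (Rep.trivial k H k) i).symm

end GroupHomology

/-! ### Full diagrams and the braided wreath product. -/

namespace BraidedRookDiagram

variable {n : ℕ} {G : Type u}

/-- The strand that starts at a given node of a full diagram. -/
def IsFull.strand {x : BraidedRookDiagram n G} (h : x.IsFull) : Fin n ↪ x.dom :=
  ⟨fun i => ⟨i, h ▸ Set.mem_univ i⟩, fun _ _ h => congrArg Subtype.val h⟩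

/-- The permutation of the nodes given by a full diagram. -/
def IsFull.perm {x : BraidedRookDiagram n G} (h : x.IsFull) : Equiv.Perm (Fin n) :=
  Equiv.ofBijective (fun i => x.tgt (h.strand i))
    (Finite.injective_iff_bijective.1 (h.strand.trans x.tgt).injective)

/-- The element of the braided wreath product given by a full diagram. -/
def IsFull.toWreath [Group G] {x : BraidedRookDiagram n G} (h : x.IsFull) : BraidedWreath n G :=
  ⟨fun i => x.label (h.strand i), ⟨h.perm, x.strands.relabel h.strand⟩⟩

/-- The full diagram given by an element of the braided wreath product. -/
def ofWreath [Group G] (w : BraidedWreath n G) : BraidedRookDiagram n G where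
  dom := Set.univ
  tgt := (Function.Embedding.subtype (· ∈ Set.univ)).trans w.right.perm.toEmbedding
  strands := w.right.strands.relabel (Function.Embedding.subtype (· ∈ Set.univ))
  label := fun i => w.left i

theorem isFull_ofWreath [Group G] (w : BraidedWreath n G) : (ofWreath w).IsFull := rfl

theorem isFull_one [Group G] : (1 : BraidedRookDiagram n G).IsFull := rfl

theorem _root_.Strands.cast_self {ι : Type} {a b : ι ↪ Fin n} (p : Strands a b) (ha : a = a)
    (hb : b = b) : p.cast ha hb = p := by
  induction p using Path.Homotopic.Quotient.ind with | mk p =>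
  rfl

/-- The type of the strands depends on the permutation, hence the transport; when the permutations
agree definitionally, `Strands.cast_self` removes it. -/
theorem _root_.Braid.ext_cast {x y : Braid n} (h : x.perm = y.perm)
    (hs : x.strands.cast rfl (by rw [h]) = y.strands) : x = y := by
  obtain ⟨f, s⟩ := x
  obtain ⟨f', s'⟩ := y
  cases h
  exact congrArg (Braid.mk f) ((Strands.cast_self s _ _).symm.trans hs)

theorem toWreath_ofWreath [Group G] (w : BraidedWreath n G) :
    (isFull_ofWreath w).toWreath = w := by
  refine congrArg (SemidirectProduct.mk w.left) (Braid.ext_cast (Equiv.ext fun i => rfl) ?_)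
  refine (Strands.cast_self _ _ _).trans ((Strands.relabel_relabel w.right.strands
    (Function.Embedding.subtype (· ∈ Set.univ)) (isFull_ofWreath w).strand).trans ?_)
  exact Strands.relabel_refl w.right.strands

theorem ofWreath_toWreath [Group G] {x : BraidedRookDiagram n G} (h : x.IsFull) :
    ofWreath h.toWreath = x := by
  obtain ⟨S, t, s, l⟩ := x
  cases (show S = Set.univ from h)
  refine mk_congr ?_ rfl
  exact (Strands.relabel_relabel s _ _).trans (Strands.relabel_refl s)

theorem toWreath_one [Group G] : (isFull_one (n := n) (G := G)).toWreath = 1 :=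
  congrArg (SemidirectProduct.mk 1) (Braid.ext_cast (Equiv.ext fun _ => rfl) rfl)

/-- In `x * y` the label at `i` is that of `x` at `i` times that of `y` at the node where the strand
of `x` ends, which is the twist by `permAction` in the semidirect product. For the strands,
successive relabellings compose to the same relabelling on both sides. -/
theorem toWreath_mul [Group G] {x y : BraidedRookDiagram n G} (hx : x.IsFull) (hy : y.IsFull)
    (h : (x * y).IsFull) : h.toWreath = hx.toWreath * hy.toWreath := by
  refine congrArg (SemidirectProduct.mk _) (Braid.ext_cast (Equiv.ext fun i => rfl) ?_)
  refine (Strands.cast_self _ _ _).trans ((Strands.relabel_comp (x.strands.relabel (compFst x y))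
    (y.strands.relabel (compSnd x y)) h.strand).trans ?_)
  exact congrArg₂ Strands.comp (Strands.relabel_relabel x.strands _ _)
    ((Strands.relabel_relabel y.strands _ _).trans
      (Strands.relabel_relabel y.strands hy.strand hx.perm.toEmbedding).symm)

/-! ### Erasing a strand. -/

/-- The straight diagram without the strand at the node `j`. -/
def eraseNode [Group G] (j : Fin n) : BraidedRookDiagram n G :=
  restrict 1 {i | i ≠ j} (Set.subset_univ _)

theorem not_isFull_eraseNode [Group G] (j : Fin n) :
    ¬ (eraseNode j : BraidedRookDiagram n G).IsFull :=
  fun h => (Set.eq_univ_iff_forall.1 h j : j ≠ j) rfl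

/-- Only strands of `x` ending at `j` could be cut, and there are none. With
`contractible_eraseNode` this says that, in the algebra, the erasing diagram multiplies `x` by `ε`.
-/
theorem mul_eraseNode [Group G] (x : BraidedRookDiagram n G) {j : Fin n}
    (hj : j ∉ Set.range x.tgt) :
    x * eraseNode j = x := by
  have hS : compDom x (eraseNode j) = x.dom := by
    ext i
    exact ⟨fun h => h.1, fun h => ⟨h, fun h' => hj ⟨⟨i, h⟩, h'⟩⟩⟩
  refine Eq.trans ?_ (x.restrict_eq (compDom x (eraseNode j)) hS.le hS)
  exact mk_congr (Strands.comp_straight _) (funext fun i => mul_one _)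

theorem contractible_eraseNode [Group G] (x : BraidedRookDiagram n G) {j : Fin n}
    (hj : j ∉ Set.range x.tgt) : contractible x (eraseNode j) = 1 := by
  rw [contractible, Set.ncard_eq_one]
  refine ⟨j, Set.ext fun i => ⟨fun h => by_contra h.2, ?_⟩⟩
  rintro rfl
  exact ⟨hj, fun h => h rfl⟩

/-- The strands of `eraseNode i` are straight, so the product has no new right endpoints. This lets
an isolated node survive the factors that precede its own in `eraseProd`. -/
theorem notMem_range_mul_eraseNode [Group G] (x : BraidedRookDiagram n G) {j : Fin n}
    (hj : j ∉ Set.range x.tgt) (i : Fin n) : j ∉ Set.range (x * eraseNode i).tgt := by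
  rw [mem_range_mul]
  rintro ⟨l, hl, h, rfl⟩
  exact hj h

/-- Counting: `tgt` is injective, so if it hit all `n` right nodes, `dom` would have `n` elements.
-/
theorem exists_notMem_range (x : BraidedRookDiagram n G) (hx : ¬ x.IsFull) :
    ∃ j, j ∉ Set.range x.tgt := by
  by_contra! h
  have hc := Set.ncard_image_of_injective Set.univ x.tgt.injective
  rw [Set.image_univ, Set.eq_univ_of_forall h, Set.ncard_univ x.dom, Nat.card_coe_set_eq] at hc
  exact hx (Set.eq_of_subset_of_ncard_le (Set.subset_univ _) hc.le)

end BraidedRookDiagram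

/-! ### The group algebra as a quotient of the rook algebra. -/

namespace BraidedRookAlgebra

open BraidedRookDiagram

variable {n : ℕ} {G k : Type u} [CommRing k] [Group G] {ε : k}

open Classical in
/-- The linear map from the braided rook algebra to the group algebra of the braided wreath product
which maps the diagrams that are not full to `0`. -/
def toGroupAlgebraLinear (n : ℕ) (G : Type u) [Group G] {k : Type u} [CommRing k] (ε : k) :
    BraidedRookAlgebra n G ε →ₗ[k] MonoidAlgebra k (BraidedWreath n G) :=
  Finsupp.lsum k fun x : BraidedRookDiagram n G => LinearMap.toSpanSingleton k _ <|
    if h : x.IsFull then MonoidAlgebra.single h.toWreath 1 else 0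

theorem toGroupAlgebraLinear_single_of_isFull {x : BraidedRookDiagram n G} (h : x.IsFull) (c : k) :
    toGroupAlgebraLinear n G ε (single ε x c) = MonoidAlgebra.single h.toWreath c := by
  refine (Finsupp.lsum_single k _ x c).trans ?_
  rw [LinearMap.toSpanSingleton_apply, dif_pos h]
  simp

theorem toGroupAlgebraLinear_single_of_not_isFull {x : BraidedRookDiagram n G} (h : ¬ x.IsFull)
    (c : k) : toGroupAlgebraLinear n G ε (single ε x c) = 0 := by
  refine (Finsupp.lsum_single k _ x c).trans ?_
  rw [LinearMap.toSpanSingleton_apply, dif_neg h, smul_zero]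

theorem toGroupAlgebraLinear_one : toGroupAlgebraLinear n G ε 1 = 1 := by
  rw [one_def, toGroupAlgebraLinear_single_of_isFull isFull_one, toWreath_one]
  rfl

/-- By `isFull_mul` the non-full diagrams span a two-sided ideal, and full diagrams multiply without
any factor `ε`. -/
theorem toGroupAlgebraLinear_mul (a b : BraidedRookAlgebra n G ε) :
    toGroupAlgebraLinear n G ε (a * b) =
      toGroupAlgebraLinear n G ε a * toGroupAlgebraLinear n G ε b := by
  induction a using induction_on with
  | h0 => rw [zero_mul, map_zero, zero_mul]
  | hadd a b ha hb => rw [add_mul, map_add, map_add, ha, hb, add_mul]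
  | hs x r =>
    induction b using induction_on with
    | h0 => rw [mul_zero, map_zero, mul_zero]
    | hadd a b ha hb => rw [mul_add, map_add, map_add, ha, hb, mul_add]
    | hs y s =>
      rw [single_mul_single]
      by_cases hx : x.IsFull
      · by_cases hy : y.IsFull
        · have h := (isFull_mul x y).2 ⟨hx, hy⟩
          rw [toGroupAlgebraLinear_single_of_isFull h, toGroupAlgebraLinear_single_of_isFull hx,
            toGroupAlgebraLinear_single_of_isFull hy, toWreath_mul hx hy,
            contractible_of_isFull x y hy, pow_zero, mul_one, MonoidAlgebra.single_mul_single]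
        · rw [toGroupAlgebraLinear_single_of_not_isFull fun h => hy ((isFull_mul x y).1 h).2,
            toGroupAlgebraLinear_single_of_not_isFull hy, mul_zero]
      · rw [toGroupAlgebraLinear_single_of_not_isFull fun h => hx ((isFull_mul x y).1 h).1,
          toGroupAlgebraLinear_single_of_not_isFull hx, zero_mul]

/-- The homomorphism from the braided rook algebra to the group algebra of the braided wreath
product which maps the diagrams that are not full to `0`. -/
def toGroupAlgebra (n : ℕ) (G : Type u) [Group G] {k : Type u} [CommRing k] (ε : k) :
    BraidedRookAlgebra n G ε →ₐ[k] MonoidAlgebra k (BraidedWreath n G) :=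
  AlgHom.ofLinearMap (toGroupAlgebraLinear n G ε) toGroupAlgebraLinear_one toGroupAlgebraLinear_mul

theorem toGroupAlgebra_single_of_isFull {x : BraidedRookDiagram n G} (h : x.IsFull) (c : k) :
    toGroupAlgebra n G ε (single ε x c) = MonoidAlgebra.single h.toWreath c :=
  toGroupAlgebraLinear_single_of_isFull h c

theorem toGroupAlgebra_single_of_not_isFull {x : BraidedRookDiagram n G} (h : ¬ x.IsFull) (c : k) :
    toGroupAlgebra n G ε (single ε x c) = 0 :=
  toGroupAlgebraLinear_single_of_not_isFull h c

theorem toGroupAlgebra_surjective : Function.Surjective (toGroupAlgebra n G ε) := by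
  intro b
  induction b using MonoidAlgebra.induction_on with
  | of w =>
    refine ⟨single ε (ofWreath w) 1, ?_⟩
    rw [toGroupAlgebra_single_of_isFull (isFull_ofWreath w), toWreath_ofWreath]
    rfl
  | add a b ha hb =>
    obtain ⟨a, rfl⟩ := ha
    obtain ⟨b, rfl⟩ := hb
    exact ⟨a + b, map_add _ _ _⟩
  | smul r a ha =>
    obtain ⟨a, rfl⟩ := ha
    exact ⟨r • a, map_smul _ _ _⟩

theorem groupAugmentation_comp_toGroupAlgebra :
    (groupAugmentation k (BraidedWreath n G)).comp (toGroupAlgebra n G ε) =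
      augmentation n G ε := by
  refine AlgHom.ext fun a => ?_
  rw [AlgHom.comp_apply]
  induction a using induction_on with
  | h0 => rw [map_zero, map_zero, map_zero]
  | hadd a b ha hb => rw [map_add, map_add, map_add, ha, hb]
  | hs x c =>
    refine Eq.trans ?_ (fullSum_single x c).symm
    by_cases h : x.IsFull
    · rw [toGroupAlgebra_single_of_isFull h, if_pos h]
      simp [groupAugmentation]
    · rw [toGroupAlgebra_single_of_not_isFull h, if_neg h, map_zero]

/-! ### The element annihilating the kernel. -/

/-- The product of the differences of the identity and the idempotents which erase a node, for the
nodes in a list. -/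
def eraseProd (δ : k) (L : List (Fin n)) : BraidedRookAlgebra n G ε :=
  (L.map fun j => 1 - single ε (eraseNode j) δ).prod

theorem toGroupAlgebra_eraseProd (δ : k) (L : List (Fin n)) :
    toGroupAlgebra n G ε (eraseProd δ L) = 1 := by
  rw [eraseProd, map_list_prod]
  refine List.prod_eq_one fun x hx => ?_
  simp only [List.mem_map] at hx
  obtain ⟨_, ⟨j, -, rfl⟩, rfl⟩ := hx
  rw [map_sub, map_one, toGroupAlgebra_single_of_not_isFull (not_isFull_eraseNode j), sub_zero]

/-- Multiplying from the left end of the list, node `j` stays isolated in every diagram that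
appears, until the factor for `j` kills everything. -/
theorem single_mul_eraseProd {δ : k} (hδ : δ * ε = 1) (L : List (Fin n)) {j : Fin n} (hj : j ∈ L)
    (x : BraidedRookDiagram n G) (hx : j ∉ Set.range x.tgt) (c : k) :
    single ε x c * eraseProd δ L = 0 := by
  -- The induction hypothesis is needed both for `x` and for `x * eraseNode i`, with different
  -- coefficients.
  induction L generalizing x c with
  | nil => simp at hj
  | cons i L ih =>
    rw [eraseProd, List.map_cons, List.prod_cons, ← eraseProd, ← mul_assoc, mul_sub, mul_one,
      single_mul_single]
    rcases List.mem_cons.1 hj with rfl | hj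
    -- Here the single contractible component contributes `ε`, which cancels `δ`.
    · rw [contractible_eraseNode x hx, mul_eraseNode x hx, pow_one, mul_assoc, hδ, mul_one,
        sub_self, zero_mul]
    · rw [sub_mul, ih hj x hx, ih hj _ (notMem_range_mul_eraseNode x hx i), sub_zero]

theorem mul_eraseProd_eq_zero {δ : k} (hδ : δ * ε = 1) (a : BraidedRookAlgebra n G ε)
    (ha : toGroupAlgebra n G ε a = 0) : a * eraseProd δ (List.finRange n) = 0 := by
  -- `s` is a `k`-linear section of the quotient map, used to project onto the kernel.
  let s : MonoidAlgebra k (BraidedWreath n G) →ₗ[k] BraidedRookAlgebra n G ε :=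
    (MonoidAlgebra.basis (BraidedWreath n G) k).constr k fun w => single ε (ofWreath w) 1
  have hs (w : BraidedWreath n G) (c : k) :
      s (MonoidAlgebra.single w c) = single ε (ofWreath w) c := by
    have h : MonoidAlgebra.single w c =
        c • MonoidAlgebra.basis (BraidedWreath n G) k w := by simp
    rw [h, map_smul, Module.Basis.constr_basis, smul_single, mul_one]
  -- Unlike membership in the kernel, this claim can be checked diagram by diagram: the difference
  -- vanishes on full diagrams and is the diagram itself on the others.
  suffices h : ∀ a : BraidedRookAlgebra n G ε,
      (a - s (toGroupAlgebra n G ε a)) * eraseProd δ (List.finRange n) = 0 by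
    simpa [ha] using h a
  intro a
  induction a using induction_on with
  | h0 => rw [map_zero, map_zero, sub_zero, zero_mul]
  | hadd a b ha hb => rw [map_add, map_add, add_sub_add_comm, add_mul, ha, hb, add_zero]
  | hs x c =>
    by_cases h : x.IsFull
    · rw [toGroupAlgebra_single_of_isFull h, hs, ofWreath_toWreath, sub_self, zero_mul]
    · obtain ⟨j, hj⟩ := exists_notMem_range x h
      rw [toGroupAlgebra_single_of_not_isFull h, map_zero, sub_zero,
        single_mul_eraseProd hδ _ (List.mem_finRange j) x hj]

end BraidedRookAlgebra

/-! ### Comparison of the `Tor` groups. -/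

/-- `Tor` over the braided rook algebra is `Tor` over the group algebra of the braided wreath
product. -/
def torBraidedRookIso (n : ℕ) (G : Type u) [Group G] {k : Type u} [CommRing k] (ε : k)
    (hε : IsUnit ε) (i : ℕ) :
    torBraidedRook n G ε i ≅ torGroupAlgebra k (BraidedWreath n G) i :=
  eqToIso (by rw [torBraidedRook, BraidedRookAlgebra.groupAugmentation_comp_toGroupAlgebra]) ≪≫
    torTrivialIso (BraidedRookAlgebra.toGroupAlgebra n G ε)
      BraidedRookAlgebra.toGroupAlgebra_surjective
      (projective_of_annihilator _ BraidedRookAlgebra.toGroupAlgebra_surjective _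
        -- The product runs over all `n` nodes with `δ = ε⁻¹`; this is the only place where
        -- invertibility of `ε` enters.
        (BraidedRookAlgebra.toGroupAlgebra_eraseProd (↑hε.unit⁻¹ : k) (List.finRange n))
        (BraidedRookAlgebra.mul_eraseProd_eq_zero hε.val_inv_mul))
      (groupAugmentation k (BraidedWreath n G)) i

theorem mainTheorem4 {G k : Type u} [Group G] [CommRing k] [MulSemiringAction G k]
    (n : ℕ) (ε : k) (hε : IsUnit ε) :
    Nonempty (∀ i : ℕ, torBraidedRook n G ε i ≃ₗ[k] torGroupAlgebra k (BraidedWreath n G) i) ∧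
    Nonempty (∀ i : ℕ, torBraidedRook n G ε i ≃ₗ[k]
      groupHomology (Rep.trivial k (BraidedWreath n G) k) i) :=
  ⟨⟨fun i => (torBraidedRookIso n G ε hε i).toLinearEquiv⟩,
    ⟨fun i => (torBraidedRookIso n G ε hε i ≪≫ torGroupAlgebraIso i).toLinearEquiv⟩⟩

end
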